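/- **Setting.** Let $d_L,d_H,N\ge 1$ and $0\le k_L<d_L$ be integers. Let $z=(l_t,h_t,l,h)$ be a random vector in $\mathbb R^{d_L}\times\mathbb R^{d_H}\times\mathbb R^{d_L}\times\mathbb R^{d_H}$ with law $\mu$ (low- and high-frequency wavelet coefficients of a noisy image and of the clean image), and let $z_1,\dots,z_N$ be i.i.d. with law $\mu$ and empirical measure $P_N$. Let $\mathcal F^L$ be a class of measurable maps $g_L:\mathbb R^{d_L}\to\mathbb R^{d_L}$ and $\mathcal F^H$ a class of measurable maps $g_H:\mathbb R^{d_L}\times\mathbb R^{d_H}\to\mathbb R^{d_H}$. For $B>0$ put $$\ell_L(\hat l,l)=\frac{\|\hat l-l\|_2^2}{4B^2d_L},\qquad \ell_H(\hat h,h)=\frac{\|\hat h-h\|_2^2}{4B^2d_H},$$ and consider the loss classes $\mathcal G^L=\{z\mapsto \ell_L(g_L(l_t),l):g_L\in\mathcal F^L\}$ and $\mathcal G^H=\{z\mapsto \ell_H(g_H(l,h_t),h):g_H\in\mathcal F^H\}$, with effective dimensions $m_{\mathcal G^L}=d_L$ and $m_{\mathcal G^H}=k_L+d_H$ (in the intended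 setting $k_L$ is the dimension of a manifold near which $l$ concentrates; it enters the result only through $m_{\mathcal G^H}$). **Assumptions.** 1. Almost surely $\|l\|_\infty\le B$ and $\|h\|_\infty\le B$, and all $g_L\in\mathcal F^L$, $g_H\in\mathcal F^H$ take values of sup-norm at most $B$. 2. Each $\mathcal G\in\{\mathcal G^L,\mathcal G^H\}$ has a finite-dimensional Lipschitz parameterization: $\mathcal G=\{\Phi_\theta:\theta\in\Theta\}$ with $\Theta\subset\mathbb R^{m_{\mathcal G}}$ bounded, and for some constant $K$, for $\mu$-almost every $z$, $|\Phi_\theta(z)-\Phi_{\theta'}(z)|\le K\|\theta-\theta'\|_2$ for all $\theta,\theta'\in\Theta$. Moreover $A\ge1$ is a constant such that, almost surely, for all $\varepsilon\in(0,1]$ and both classes, the covering number is finite and $\log\mathcal N(\varepsilon,\mathcal G,L_2(P_N))\le m_{\mathcal G}\log(A/\varepsilon)$. 3. $L_{\mathrm{cond}}>0$ satisfies $\|g_H(x,y)-g_H(x',y)\|_2\le L_{\mathrm{cond}}\|x-x'\|_2$ for all $g_H\in\mathcal F^H$, $x,x'\in\mathbb R^{d_L}$, $y\in\mathbb R^{d_H}$.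 **Risks.** The practical risk, in which the high-frequency branch is conditioned on the predicted low frequency, and the empirical decoupled risk, in which it is conditioned on the true one, are $$R_{\mathrm{real}}(g_L,g_H)=\mathbb E\bigl[\ell_L(g_L(l_t),l)+\ell_H(g_H(g_L(l_t),h_t),h)\bigr],$$ $$\widehat R_{\mathrm{dec}}(g_L,g_H)=\frac1N\sum_{i=1}^N\ell_L\bigl(g_L(l_t^{(i)}),l^{(i)}\bigr)+\frac1N\sum_{i=1}^N\ell_H\bigl(g_H(l^{(i)},h_t^{(i)}),h^{(i)}\bigr).$$ **Corollary.** Fix $g_L\in\mathcal F^L$ (not depending on the sample) and $\delta\in(0,1)$. Then with probability at least $1-\delta$ over the sample, simultaneously for all $g_H\in\mathcal F^H$, $$R_{\mathrm{real}}(g_L,g_H)\le\widehat R_{\mathrm{dec}}(g_L,g_H)+\frac{12A\sqrt\pi}{\sqrt N}\bigl(\sqrt{d_L}+\sqrt{k_L+d_H}\bigr)+\frac{L_{\mathrm{cond}}}{B\sqrt{d_H}}\,\mathbb E\|g_L(l_t)-l\|_2+3\sqrt{\frac{2\log(8/\delta)}{N}}.$$ -/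

import Mathlib

open MeasureTheory ProbabilityTheory
open scoped NNReal ENNReal

noncomputable section

namespace FreqDecoupling

/-- `ℝᵈ` with the Euclidean norm. -/
abbrev E (d : ℕ) : Type := EuclideanSpace ℝ (Fin d)

/-- A data point `z = (l_t, h_t, l, h)`: the low- and high-frequency coefficients of the noisy
state, followed by those of the clean target. -/
abbrev Sample (dL dH : ℕ) : Type := E dL × E dH × E dL × E dH

variable {dL dH : ℕ}

/-- noisy low-frequency component `l_t` -/
def Sample.lt (z : Sample dL dH) : E dL := z.1
/-- noisy high-frequency component `h_t` -/
def Sample.ht (z : Sample dL dH) : E dH := z.2.1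
/-- clean low-frequency component `l` -/
def Sample.l (z : Sample dL dH) : E dL := z.2.2.1
/-- clean high-frequency component `h` -/
def Sample.h (z : Sample dL dH) : E dH := z.2.2.2

/-- `‖x‖_∞ ≤ B`. -/
def SupBounded {d : ℕ} (B : ℝ) (x : E d) : Prop := ∀ i, |x i| ≤ B

/-- The normalized squared loss `‖x̂ - x‖₂² / (4 B² d)` on `ℝᵈ`. -/
def normLoss {d : ℕ} (B : ℝ) (xhat x : E d) : ℝ := ‖xhat - x‖ ^ 2 / (4 * B ^ 2 * d)

/-- Loss of the low-frequency branch `g_L` at `z`. -/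
def lossL (B : ℝ) (gL : E dL → E dL) (z : Sample dL dH) : ℝ :=
  normLoss B (gL (Sample.lt z)) (Sample.l z)

/-- Teacher-forced loss of the high-frequency branch: `g_H` sees the true `l`. -/
def lossH (B : ℝ) (gH : E dL × E dH → E dH) (z : Sample dL dH) : ℝ :=
  normLoss B (gH (Sample.l z, Sample.ht z)) (Sample.h z)

/-- Practical loss of the high-frequency branch: `g_H` sees the prediction `g_L(l_t)`. -/
def lossHReal (B : ℝ) (gL : E dL → E dL) (gH : E dL × E dH → E dH) (z : Sample dL dH) : ℝ :=
  normLoss B (gH (gL (Sample.lt z), Sample.ht z)) (Sample.h z)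

/-- The loss class induced by a class of low-frequency predictors. -/
def lossClassL (B : ℝ) (FL : Set (E dL → E dL)) : Set (Sample dL dH → ℝ) :=
  {f | ∃ gL ∈ FL, f = lossL B gL}

/-- The (teacher-forced) loss class induced by a class of high-frequency predictors. -/
def lossClassH (B : ℝ) (FH : Set (E dL × E dH → E dH)) : Set (Sample dL dH → ℝ) :=
  {f | ∃ gH ∈ FH, f = lossH B gH}

/-- The practical risk `E[ℓ_L(g_L(l_t), l) + ℓ_H(g_H(g_L(l_t), h_t), h)]`. -/
def riskReal (μ : Measure (Sample dL dH)) (B : ℝ) (gL : E dL → E dL)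
    (gH : E dL × E dH → E dH) : ℝ :=
  ∫ z, (lossL B gL z + lossHReal B gL gH z) ∂μ

/-- The empirical decoupled (teacher-forced) risk on the sample `z₁, …, z_N`. -/
def empRiskDec {N : ℕ} (z : Fin N → Sample dL dH) (B : ℝ) (gL : E dL → E dL)
    (gH : E dL × E dH → E dH) : ℝ :=
  (∑ i, lossL B gL (z i)) / N + (∑ i, lossH B gH (z i)) / N

/-- The class `G` admits a parameterization by a bounded set of parameters in `ℝᵐ` with respect to
which its members are uniformly Lipschitz, at almost every data point. -/
def HasLipschitzParam {𝒳 : Type*} [MeasurableSpace 𝒳] (μ : Measure 𝒳) (m : ℕ)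
    (G : Set (𝒳 → ℝ)) : Prop :=
  ∃ (Θ : Set (E m)) (Φ : E m → 𝒳 → ℝ) (K : ℝ), Bornology.IsBounded Θ ∧ Φ '' Θ = G ∧
    ∀ᵐ z ∂μ, ∀ θ ∈ Θ, ∀ θ' ∈ Θ, |Φ θ z - Φ θ' z| ≤ K * dist θ θ'

/-- The values of `f` on the sample, scaled by `1/√N`: the Euclidean distance between `empVec z f`
and `empVec z g` is the `L₂(P_N)` distance `(N⁻¹ ∑ (f zᵢ - g zᵢ)²)^{1/2}`. -/
def empVec {𝒳 : Type*} {N : ℕ} (z : Fin N → 𝒳) (f : 𝒳 → ℝ) : E N :=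
  WithLp.toLp 2 (fun i => f (z i) / Real.sqrt N)

/-- The covering number `𝒩(ε, G, L₂(P_N))` (the centres need not belong to `G`). -/
def empCoveringNumber {𝒳 : Type*} {N : ℕ} (z : Fin N → 𝒳) (ε : ℝ≥0) (G : Set (𝒳 → ℝ)) : ℕ∞ :=
  Metric.externalCoveringNumber ε (empVec z '' G)

/-- The metric-entropy growth condition: for all `ε ∈ (0,1]` the covering number is finite and
`log 𝒩(ε, G, L₂(P_N)) ≤ m log (A/ε)`. -/
def EntropyGrowth {𝒳 : Type*} {N : ℕ} (z : Fin N → 𝒳) (m : ℕ) (A : ℝ) (G : Set (𝒳 → ℝ)) : Prop :=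
  ∀ ε : ℝ≥0, 0 < ε → ε ≤ 1 →
    empCoveringNumber z ε G ≠ ⊤ ∧
      Real.log ((empCoveringNumber z ε G).toNat : ℝ) ≤ m * Real.log (A / ε)

end FreqDecoupling

end

/-! Feeding `g_H` the predicted instead of the true low frequency costs at most `Lcond * ‖g_L(l_t) -
l‖ / (B √dH)` at almost every data point, because the normalized loss is Lipschitz in the prediction
(`normLoss_le_add`, `riskReal_le`). It remains to compare population and empirical teacher-forced
risks. As `g_L` is fixed, its loss is one bounded function and a Hoeffding bound suffices
(`single_deviation_le`); only `g_H` needs a uniform bound (`uniform_deviation_le`).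

Both bounds are obtained from exponential moments, so that Markov's inequality yields the tail
directly and no separate concentration inequality is needed. Jensen over a ghost sample, followed by
random swaps, bounds the exponential moment at `c` of the largest deviation by the Rademacher moment
at `2 * c` (`measure_exists_deviation_le`).

The Rademacher moment is bounded by chaining (`exists_chaining_majorant`). The link at scale `k` has
length at most `2 / 3 ^ (k + 1)`, and these lengths sum to at most one. They therefore serve as
convex weights: Jensen for `exp` replaces the chain by an average of exponentials of normalized
links, each sub-Gaussian once the log-number of links is subtracted. Polynomial entropy makes the
weighted entropy sum at most `10 * m * A` (`exists_entropy_majorant`).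

The Lipschitz parameterization is used only qualitatively: it reduces the supremum to a finite
family, hence a measurable one, at a cost of order `1 / √N` and independently of the size of the
net. -/

noncomputable section

namespace FreqDecoupling

open scoped BigOperators

/-! ### Rademacher averages over the sign cube -/

/-- The sign attached to a Boolean. -/
def sgn (b : Bool) : ℝ := if b then 1 else -1

lemma abs_sgn (b : Bool) : |sgn b| = 1 := by cases b <;> simp [sgn]

lemma sgn_not (b : Bool) : sgn (!b) = -sgn b := by cases b <;> simp [sgn]

lemma sum_exp_sgn_mul (a : ℝ) : ∑ b : Bool, Real.exp (sgn b * a) = 2 * Real.cosh a := by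
  simp [sgn, Real.cosh_eq]; ring

/-- Rademacher sums are sub-Gaussian. -/
lemma expect_exp_sum_sgn_le {κ : Type*} [Fintype κ] [DecidableEq κ] (a : κ → ℝ) :
    𝔼 σ : κ → Bool, Real.exp (∑ i, sgn (σ i) * a i) ≤ Real.exp ((∑ i, a i ^ 2) / 2) := by
  have h : ∑ σ : κ → Bool, Real.exp (∑ i, sgn (σ i) * a i) = ∏ i, (2 * Real.cosh (a i)) := by
    simp_rw [← sum_exp_sgn_mul, Real.exp_sum]
    rw [Finset.prod_univ_sum, Fintype.piFinset_univ]
  rw [Finset.expect_eq_sum_div_card, h, Finset.prod_mul_distrib]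
  simp only [Finset.prod_const, Finset.card_univ, Fintype.card_pi, Fintype.card_bool]
  rw [Nat.cast_pow, Nat.cast_ofNat, mul_div_cancel_left₀ _ (by positivity), Finset.sum_div,
    Real.exp_sum]
  exact Finset.prod_le_prod (fun i _ => (Real.cosh_pos _).le)
    fun i _ => Real.cosh_le_exp_half_sq _

lemma expect_flip {κ : Type*} [Fintype κ] [DecidableEq κ] (F : (κ → Bool) → ℝ) :
    𝔼 σ : κ → Bool, F (fun i => !σ i) = 𝔼 σ : κ → Bool, F σ := by
  refine Fintype.expect_bijective (fun (σ : κ → Bool) i => !σ i) ?_ _ _ fun _ => rfl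
  exact Function.Involutive.bijective fun σ => by simp

/-! ### Chaining -/

/-- Jensen's inequality for `exp` with total weight at most one. -/
lemma exp_sum_mul_le {ι : Type*} (s : Finset ι) (w p : ι → ℝ) (hw : ∀ i ∈ s, 0 ≤ w i)
    (hs : ∑ i ∈ s, w i ≤ 1) :
    Real.exp (∑ i ∈ s, w i * p i) ≤ (1 - ∑ i ∈ s, w i) + ∑ i ∈ s, w i * Real.exp (p i) := by
  have := convexOn_exp.map_add_sum_le (t := s) (w := w) (p := p) (v := 1 - ∑ i ∈ s, w i) (q := 0)
    hw (by ring) (fun _ _ => Set.mem_univ _) (by linarith) (Set.mem_univ _)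
  simpa using this

/-- The ratio 3 of successive radii makes the link lengths a sub-probability; the first moment in
the next lemma sums the linear growth of the entropy in the scale. -/
lemma sum_chain_weights (K : ℕ) :
    ∑ k ∈ Finset.range K, (2 / 3 ^ (k + 1) : ℝ) = 1 - 1 / 3 ^ K := by
  induction K with
  | zero => simp
  | succ K ih => rw [Finset.sum_range_succ, ih]; field_simp; ring

lemma sum_mul_chain_weights (K : ℕ) :
    ∑ k ∈ Finset.range K, (2 / 3 ^ (k + 1) * (k + 1) : ℝ) = 3 / 2 - (2 * K + 3) / (2 * 3 ^ K) := by
  induction K with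
  | zero => norm_num
  | succ K ih => rw [Finset.sum_range_succ, ih]; push_cast; field_simp; ring

/-- Dividing a link by its length bound leaves variance proxy at most `s ^ 2`, which the subtracted
`s ^ 2 / 2` cancels. The extra `b` pays for the union over links. -/
lemma expect_exp_link_le {N : ℕ} (v : E N) (s w b : ℝ) (hw : 0 < w) (hv : ‖v‖ ≤ w) :
    𝔼 σ : Fin N → Bool, Real.exp (∑ i, sgn (σ i) * (s / w * v i) - (b + s ^ 2 / 2))
      ≤ Real.exp (-b) := by
  have h1 : ∀ σ : Fin N → Bool, Real.exp (∑ i, sgn (σ i) * (s / w * v i) - (b + s ^ 2 / 2)) =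
      Real.exp (∑ i, sgn (σ i) * (s / w * v i)) * Real.exp (-(b + s ^ 2 / 2)) := by
    intro σ; rw [← Real.exp_add, sub_eq_add_neg]
  simp_rw [h1]
  rw [← Finset.expect_mul]
  calc _ ≤ Real.exp ((∑ i, (s / w * v i) ^ 2) / 2) * Real.exp (-(b + s ^ 2 / 2)) := by
        gcongr; exact expect_exp_sum_sgn_le _
    _ ≤ Real.exp (s ^ 2 / 2) * Real.exp (-(b + s ^ 2 / 2)) := by
        gcongr
        simp_rw [mul_pow]
        rw [← Finset.mul_sum]
        have : ∑ i, v i ^ 2 = ‖v‖ ^ 2 := by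
          rw [EuclideanSpace.norm_sq_eq]; simp
        rw [this, div_pow]
        calc s ^ 2 / w ^ 2 * ‖v‖ ^ 2 ≤ s ^ 2 / w ^ 2 * w ^ 2 := by gcongr
          _ = s ^ 2 := by field_simp
    _ = Real.exp (-b) := by rw [← Real.exp_add]; ring_nf

lemma abs_sum_sgn_mul_le {N : ℕ} (σ : Fin N → Bool) (v : E N) :
    |∑ i, sgn (σ i) * v i| ≤ Real.sqrt N * ‖v‖ := by
  have h := Finset.sum_mul_sq_le_sq_mul_sq Finset.univ (fun i => sgn (σ i)) (fun i => v i)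
  have h1 : ∑ i, sgn (σ i) ^ 2 = (N : ℝ) := by
    simp [← sq_abs (sgn _), abs_sgn]
  have h2 : ∑ i, v i ^ 2 = ‖v‖ ^ 2 := by
    rw [EuclideanSpace.norm_sq_eq]; simp
  rw [h1, h2] at h
  refine abs_le_of_sq_le_sq ?_ (by positivity)
  rwa [mul_pow, Real.sq_sqrt (by positivity)]

/-- Chaining along finite nets of radius `(1/2) 3⁻ᵏ`: a majorant of the exponential of the Rademacher
process, uniform over the index set. -/
lemma exists_chaining_majorant {N : ℕ} (T : Set (E N)) (t₀ : E N) (C : ℕ → Finset (E N))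
    (hC0 : C 0 = {t₀}) (hC : ∀ k, ∀ t ∈ T, ∃ c ∈ C k, dist t c ≤ 1 / 2 / 3 ^ k)
    (s : ℝ) (hs : 0 ≤ s) (K : ℕ) :
    ∃ G : (Fin N → Bool) → ℝ, 𝔼 σ, G σ ≤ 1 ∧ ∀ σ, ∀ t ∈ T,
      Real.exp (s * ∑ i, sgn (σ i) * (t i - t₀ i)
        - (s * (Real.sqrt N * (1 / 2 / 3 ^ K)) + ∑ k ∈ Finset.range K, 2 / 3 ^ (k + 1) *
          (Real.log (C k).card + Real.log (C (k + 1)).card + s ^ 2 / 2))) ≤ G σ := by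
  classical
  set w : ℕ → ℝ := fun k => 2 / 3 ^ (k + 1) with hw
  have hwpos : ∀ k, 0 < w k := fun k => by positivity
  have hwsum : ∀ K, ∑ k ∈ Finset.range K, w k ≤ 1 := by
    intro K
    rw [hw, sum_chain_weights]
    have : (0 : ℝ) < 1 / 3 ^ K := by positivity
    linarith
  set b : ℕ → ℝ := fun k => Real.log (C k).card + Real.log (C (k + 1)).card with hb
  set L : ℕ → Finset (E N × E N) := fun k =>
    (C k ×ˢ C (k + 1)).filter fun p => ‖p.2 - p.1‖ ≤ w k with hL
  set g : ℕ → (Fin N → Bool) → ℝ := fun k σ => ∑ p ∈ L k,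
    Real.exp (∑ i, sgn (σ i) * (s / w k * (p.2 - p.1) i) - (b k + s ^ 2 / 2)) with hg
  have hgE : ∀ k, 𝔼 σ, g k σ ≤ 1 := by
    intro k
    rw [hg]
    simp only
    rw [Finset.expect_sum_comm]
    calc _ ≤ ∑ p ∈ L k, Real.exp (-(b k)) := by
          refine Finset.sum_le_sum fun p hp => ?_
          exact expect_exp_link_le _ _ _ _ (hwpos k) (Finset.mem_filter.1 hp).2
      _ = (L k).card * Real.exp (-(b k)) := by simp
      _ ≤ ((C k).card * (C (k + 1)).card : ℝ) * Real.exp (-(b k)) := by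
          gcongr
          exact_mod_cast (Finset.card_filter_le _ _).trans_eq (Finset.card_product _ _)
      _ ≤ 1 := by
          -- `b k` is the logarithm of the number of pairs only when both nets are nonempty;
          -- otherwise there are no links.
          rcases Nat.eq_zero_or_pos (C k).card with h0 | h0
          · simp [h0]
          rcases Nat.eq_zero_or_pos (C (k + 1)).card with h1 | h1
          · simp [h1]
          have h0' : (0 : ℝ) < (C k).card := by exact_mod_cast h0
          have h1' : (0 : ℝ) < (C (k + 1)).card := by exact_mod_cast h1
          rw [Real.exp_neg, hb]
          simp only
          rw [Real.exp_add, Real.exp_log h0', Real.exp_log h1']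
          exact (mul_inv_cancel₀ (by positivity)).le
  refine ⟨fun σ => (1 - ∑ k ∈ Finset.range K, w k) + ∑ k ∈ Finset.range K, w k * g k σ, ?_, ?_⟩
  · rw [Finset.expect_add_distrib, Fintype.expect_const, Finset.expect_sum_comm]
    have : ∑ k ∈ Finset.range K, 𝔼 σ, w k * g k σ ≤ ∑ k ∈ Finset.range K, w k := by
      refine Finset.sum_le_sum fun k _ => ?_
      rw [← Finset.mul_expect]
      exact mul_le_of_le_one_right (hwpos k).le (hgE k)
    linarith
  · intro σ t ht
    choose c hcC hcd using fun k => hC k t ht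
    have hc0 : c 0 = t₀ := by have := hcC 0; rw [hC0] at this; simpa using this
    have hlink : ∀ k, ‖c (k + 1) - c k‖ ≤ w k := by
      intro k
      rw [← dist_eq_norm]
      calc _ ≤ dist (c (k + 1)) t + dist t (c k) := dist_triangle _ _ _
        _ ≤ 1 / 2 / 3 ^ (k + 1) + 1 / 2 / 3 ^ k := by
            rw [dist_comm]; exact add_le_add (hcd _) (hcd _)
        -- Two consecutive radii add up to `(1 / 2) * (4 / 3) / 3 ^ k`, which is where the weight
        -- comes from.
        _ = w k := by rw [hw]; field_simp; ring
    have htel : ∀ i, t i - t₀ i = (t - c K) i + ∑ k ∈ Finset.range K, (c (k + 1) - c k) i := by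
      intro i
      have := Finset.sum_range_sub (fun k => c k i) K
      simp only [PiLp.sub_apply]
      rw [this, hc0]; ring
    have hsum : s * ∑ i, sgn (σ i) * (t i - t₀ i) = s * ∑ i, sgn (σ i) * (t - c K) i +
        ∑ k ∈ Finset.range K, w k * ∑ i, sgn (σ i) * (s / w k * (c (k + 1) - c k) i) := by
      have h2 : ∀ k, w k * ∑ i, sgn (σ i) * (s / w k * (c (k + 1) - c k) i) =
          ∑ i, s * (sgn (σ i) * (c (k + 1) - c k) i) := by
        intro k
        rw [Finset.mul_sum]
        refine Finset.sum_congr rfl fun i _ => ?_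
        have := (hwpos k).ne'
        field_simp
      simp_rw [h2, htel, mul_add, Finset.sum_add_distrib, mul_add]
      congr 1
      simp_rw [Finset.mul_sum]
      rw [Finset.sum_comm]
    have hres : s * ∑ i, sgn (σ i) * (t - c K) i ≤ s * (Real.sqrt N * (1 / 2 / 3 ^ K)) := by
      gcongr
      refine (le_abs_self _).trans ((abs_sum_sgn_mul_le σ _).trans ?_)
      gcongr
      rw [← dist_eq_norm]
      exact hcd K
    calc _ ≤ Real.exp (∑ k ∈ Finset.range K, w k *
          (∑ i, sgn (σ i) * (s / w k * (c (k + 1) - c k) i) - (b k + s ^ 2 / 2))) := by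
          refine Real.exp_le_exp.2 ?_
          have h3 : ∀ k, w k * (∑ i, sgn (σ i) * (s / w k * (c (k + 1) - c k) i)
              - (b k + s ^ 2 / 2)) = w k * ∑ i, sgn (σ i) * (s / w k * (c (k + 1) - c k) i)
              - w k * (b k + s ^ 2 / 2) := fun k => mul_sub _ _ _
          rw [Finset.sum_congr rfl fun k _ => h3 k, Finset.sum_sub_distrib, hsum]
          linarith
      _ ≤ _ := exp_sum_mul_le _ _ _ (fun k _ => (hwpos k).le) (hwsum K)
      _ ≤ _ := by
          refine add_le_add le_rfl (Finset.sum_le_sum fun k _ =>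
            mul_le_mul_of_nonneg_left ?_ (hwpos k).le)
          exact Finset.single_le_sum
              (f := fun p : E N × E N => Real.exp
                (∑ i, sgn (σ i) * (s / w k * (p.2 - p.1) i) - (b k + s ^ 2 / 2)))
              (fun _ _ => (Real.exp_pos _).le)
              (Finset.mem_filter.2 ⟨Finset.mk_mem_product (hcC k) (hcC (k + 1)), hlink k⟩)

/-- An infimum in `ℕ∞` over a nonempty family is attained, so an optimal net exists. -/
lemma exists_finset_of_externalCoveringNumber_ne_top {X : Type*} [PseudoMetricSpace X] (T : Set X)
    (ε : ℝ≥0) (h : Metric.externalCoveringNumber ε T ≠ ⊤) :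
    ∃ C : Finset X, C.card = (Metric.externalCoveringNumber ε T).toNat ∧
      ∀ t ∈ T, ∃ c ∈ C, dist t c ≤ ε := by
  have : Nonempty {C : Set X // Metric.IsCover ε T C} := ⟨⟨T, Metric.IsCover.rfl⟩⟩
  obtain ⟨⟨C, hC⟩, hCe⟩ := ENat.exists_eq_iInf (fun C : {C : Set X // Metric.IsCover ε T C} =>
    C.1.encard)
  have he : Metric.externalCoveringNumber ε T = C.encard := by
    rw [Metric.externalCoveringNumber, hCe, iInf_subtype]
  have hfin : C.Finite := by
    rw [← Set.encard_ne_top_iff, ← he]; exact h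
  refine ⟨hfin.toFinset, ?_, fun t ht => ?_⟩
  · rw [he, hfin.encard_eq_coe_toFinset_card]; simp
  · obtain ⟨c, hc, hd⟩ := hC ht
    refine ⟨c, by simpa using hc, ?_⟩
    have hd' : edist t c ≤ ε := hd
    rwa [edist_nndist, ENNReal.coe_le_coe, ← NNReal.coe_le_coe, coe_nndist] at hd'

/-- The Rademacher process indexed by a set of radius `1/2` with polynomial entropy. -/
lemma exists_entropy_majorant {N : ℕ} (T : Set (E N)) (t₀ : E N) (m : ℕ) (A : ℝ) (hA : 1 ≤ A)
    (hT : ∀ t ∈ T, dist t t₀ ≤ 1 / 2)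
    (hcov : ∀ ε : ℝ≥0, 0 < ε → ε ≤ 1 → Metric.externalCoveringNumber ε T ≠ ⊤ ∧
      Real.log ((Metric.externalCoveringNumber ε T).toNat : ℝ) ≤ m * Real.log (A / ε))
    (s : ℝ) (hs : 0 ≤ s) :
    ∃ G : (Fin N → Bool) → ℝ, 𝔼 σ, G σ ≤ 1 ∧ ∀ σ, ∀ t ∈ T,
      Real.exp (s * ∑ i, sgn (σ i) * (t i - t₀ i) - (s + 10 * m * A + s ^ 2 / 2)) ≤ G σ := by
  have hex : ∀ k : ℕ, ∃ C : Finset (E N), Real.log C.card ≤ m * (2 * A + 2 * k) ∧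
      ∀ t ∈ T, ∃ c ∈ C, dist t c ≤ 1 / 2 / 3 ^ k := by
    intro k
    have hε : ((1 / 2 / 3 ^ k : ℝ≥0) : ℝ) = 1 / 2 / 3 ^ k := by push_cast; rfl
    have hε1 : (1 / 2 / 3 ^ k : ℝ≥0) ≤ 1 := by
      rw [← NNReal.coe_le_coe, hε, div_div, NNReal.coe_one]
      refine div_le_one_of_le₀ ?_ (by positivity)
      have : (1 : ℝ) ≤ 3 ^ k := one_le_pow₀ (by norm_num)
      linarith
    obtain ⟨h1, h2⟩ := hcov (1 / 2 / 3 ^ k) (by positivity) hε1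
    obtain ⟨C, hC, hCc⟩ := exists_finset_of_externalCoveringNumber_ne_top T _ h1
    refine ⟨C, ?_, by simpa only [hε] using hCc⟩
    rw [hC]
    refine h2.trans ?_
    gcongr
    rw [hε]
    have h3 : A / (1 / 2 / 3 ^ k) = (2 * A) * 3 ^ k := by field_simp
    rw [h3, Real.log_mul (by positivity) (by positivity), Real.log_pow]
    -- The crude bounds `log (2 * A) ≤ 2 * A` and `log 3 ≤ 2` make the entropy linear in `A` and in
    -- `k`.
    have h4 := Real.log_le_sub_one_of_pos (show 0 < 2 * A by linarith)
    have h5 := Real.log_le_sub_one_of_pos (show (0 : ℝ) < 3 by norm_num)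
    have h6 : (k : ℝ) * Real.log 3 ≤ k * 2 := by gcongr; linarith
    linarith
  choose C' hC'card hC' using hex
  -- At scale 0 the radius is `1 / 2`, so the centre alone is a net and all chains start there.
  set C : ℕ → Finset (E N) := fun k => if k = 0 then {t₀} else C' k with hCdef
  have hCcard : ∀ k, Real.log (C k).card ≤ m * (2 * A + 2 * k) := by
    intro k
    by_cases hk : k = 0
    · simp only [hCdef, hk, if_true, Finset.card_singleton]; simp; positivity
    · simpa only [hCdef, hk, if_false] using hC'card k
  have hC : ∀ k, ∀ t ∈ T, ∃ c ∈ C k, dist t c ≤ 1 / 2 / 3 ^ k := by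
    intro k t ht
    by_cases hk : k = 0
    · subst hk; exact ⟨t₀, by simp [hCdef], by simpa using hT t ht⟩
    · simpa only [hCdef, hk, if_false] using hC' k t ht
  -- At this depth the unchained remainder, bounded by Cauchy–Schwarz, contributes at most `s`.
  obtain ⟨K, hK⟩ : ∃ K : ℕ, Real.sqrt N < 3 ^ K := pow_unbounded_of_one_lt _ (by norm_num)
  obtain ⟨G, hG1, hG⟩ := exists_chaining_majorant T t₀ C (by simp [hCdef]) hC s hs K
  refine ⟨G, hG1, fun σ t ht => le_trans (Real.exp_le_exp.2 ?_) (hG σ t ht)⟩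
  have h1 : Real.sqrt N * (1 / 2 / 3 ^ K) ≤ 1 := by
    rw [div_div, mul_one_div]
    exact div_le_one_of_le₀ (by linarith [Real.sqrt_nonneg (N : ℝ)]) (by positivity)
  have h2 : ∑ k ∈ Finset.range K, 2 / 3 ^ (k + 1) *
          (Real.log (C k).card + Real.log (C (k + 1)).card + s ^ 2 / 2) ≤
      ∑ k ∈ Finset.range K, ((2 / 3 ^ (k + 1) : ℝ) * (m * (4 * A) + s ^ 2 / 2) +
        (2 / 3 ^ (k + 1) * (k + 1) : ℝ) * (m * 4)) := by
    refine Finset.sum_le_sum fun k _ => ?_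
    have := hCcard k
    have h' := hCcard (k + 1)
    push_cast at h'
    have hm : (0 : ℝ) ≤ m := by positivity
    calc _ ≤ (2 / 3 ^ (k + 1) : ℝ) * ((m * (4 * A) + s ^ 2 / 2) + (k + 1) * (m * 4)) := by
          refine mul_le_mul_of_nonneg_left ?_ (by positivity)
          linarith
      _ = _ := by ring
  rw [Finset.sum_add_distrib, ← Finset.sum_mul, ← Finset.sum_mul, sum_chain_weights,
    sum_mul_chain_weights] at h2
  have h3 : (1 - 1 / 3 ^ K : ℝ) * (m * (4 * A) + s ^ 2 / 2) ≤ 1 * (m * (4 * A) + s ^ 2 / 2) := by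
    gcongr
    have : (0 : ℝ) < 1 / 3 ^ K := by positivity
    linarith
  have h4 : (3 / 2 - (2 * K + 3) / (2 * 3 ^ K) : ℝ) * (m * 4) ≤ 3 / 2 * (m * 4) := by
    gcongr
    have : (0 : ℝ) ≤ (2 * K + 3) / (2 * 3 ^ K) := by positivity
    linarith
  have h5 : s * (Real.sqrt N * (1 / 2 / 3 ^ K)) ≤ s * 1 := by gcongr
  have h6 : (m : ℝ) * 1 ≤ m * A := by gcongr
  -- The entropy contributes `4 * m * A + (3 / 2) * 4 * m`, at most `10 * m * A` since `A ≥ 1`.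
  nlinarith

/-! ### Symmetrization for finite classes -/

/-- The maximum of a finite nonempty family of reals. -/
def famMax {ι : Type*} [Fintype ι] [Nonempty ι] (x : ι → ℝ) : ℝ :=
  Finset.univ.sup' Finset.univ_nonempty x

section famMax

variable {ι : Type*} [Fintype ι] [Nonempty ι]

lemma le_famMax (x : ι → ℝ) (j : ι) : x j ≤ famMax x :=
  Finset.le_sup' x (Finset.mem_univ j)

lemma famMax_le {x : ι → ℝ} {a : ℝ} (h : ∀ j, x j ≤ a) : famMax x ≤ a :=
  Finset.sup'_le _ _ fun j _ => h j

lemma measurable_famMax {α : Type*} [MeasurableSpace α] {f : α → ι → ℝ}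
    (hf : ∀ j, Measurable fun a => f a j) : Measurable fun a => famMax (f a) := by
  have := Finset.measurable_sup' (s := (Finset.univ : Finset ι)) Finset.univ_nonempty
    (f := fun j a => f a j) fun j _ => hf j
  convert this using 1
  ext a
  simp [famMax, Finset.sup'_apply]

lemma integrable_famMax_exp {α : Type*} [MeasurableSpace α] {ν : Measure α} [IsFiniteMeasure ν]
    {f : α → ι → ℝ} (hf : ∀ j, Measurable fun a => f a j) {c : ℝ} (hc : ∀ a j, f a j ≤ c) :
    Integrable (fun a => famMax fun j => Real.exp (f a j)) ν := by
  refine Integrable.of_bound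
    (measurable_famMax fun j => (hf j).exp).aestronglyMeasurable (Real.exp c)
    (Filter.Eventually.of_forall fun a => ?_)
  obtain ⟨j⟩ := ‹Nonempty ι›
  rw [Real.norm_eq_abs, abs_of_nonneg]
  · exact famMax_le fun j => Real.exp_le_exp.2 (hc a j)
  · exact (Real.exp_pos _).le.trans (le_famMax (fun j => Real.exp (f a j)) j)

end famMax

section symm

variable {𝒳 : Type*} {ι : Type*} [Fintype ι] [Nonempty ι] {N : ℕ}

/-- The symmetrized exponential process attached to signs and a double sample. -/
def symProc (g : ι → 𝒳 → ℝ) (c : ℝ) (σ : Fin N → Bool) (p : Fin N → 𝒳 × 𝒳) : ℝ :=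
  famMax fun j => Real.exp (c * ∑ i, sgn (σ i) * (g j (p i).2 - g j (p i).1))

/-- The exponential Rademacher process of a class centred at `1/2`. -/
def radProc (g : ι → 𝒳 → ℝ) (c : ℝ) (σ : Fin N → Bool) (z : Fin N → 𝒳) : ℝ :=
  famMax fun j => Real.exp (c * ∑ i, sgn (σ i) * (g j (z i) - 1 / 2))

lemma sgn_mul_le_one (b : Bool) {x : ℝ} (hx : |x| ≤ 1) : sgn b * x ≤ 1 :=
  (le_abs_self _).trans (by rw [abs_mul, abs_sgn, one_mul]; exact hx)

lemma mul_sum_sgn_le {c : ℝ} (hc : 0 ≤ c) (σ : Fin N → Bool) (x : Fin N → ℝ)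
    (hx : ∀ i, |x i| ≤ 1) : c * ∑ i, sgn (σ i) * x i ≤ c * N := by
  gcongr
  calc _ ≤ ∑ _i : Fin N, (1 : ℝ) := Finset.sum_le_sum fun i _ => sgn_mul_le_one _ (hx i)
    _ = N := by simp

lemma abs_sub_le_one_of_mem_Icc {x y : ℝ} (hx : x ∈ Set.Icc (0 : ℝ) 1)
    (hy : y ∈ Set.Icc (0 : ℝ) 1) : |x - y| ≤ 1 := by
  rw [abs_le]; constructor <;> linarith [hx.1, hx.2, hy.1, hy.2]

/-- The centring constant cancels in the difference, and convexity of `exp` at the midpoint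
separates the two samples at the price of doubling `c`. -/
lemma symProc_le (g : ι → 𝒳 → ℝ) (c : ℝ) (σ : Fin N → Bool) (p : Fin N → 𝒳 × 𝒳) :
    symProc g c σ p ≤ (radProc g (2 * c) σ (fun i => (p i).2)
      + radProc g (2 * c) (fun i => !σ i) (fun i => (p i).1)) / 2 := by
  refine famMax_le fun j => ?_
  set u := 2 * c * ∑ i, sgn (σ i) * (g j (p i).2 - 1 / 2) with hu
  set v := 2 * c * ∑ i, sgn (!σ i) * (g j (p i).1 - 1 / 2) with hv
  have huv : c * ∑ i, sgn (σ i) * (g j (p i).2 - g j (p i).1) = 1 / 2 * u + 1 / 2 * v := by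
    rw [hu, hv]
    simp_rw [sgn_not, Finset.mul_sum, ← Finset.sum_add_distrib]
    refine Finset.sum_congr rfl fun i _ => ?_
    ring
  have h := convexOn_exp.2 (Set.mem_univ u) (Set.mem_univ v) (show (0 : ℝ) ≤ 1 / 2 by norm_num)
    (show (0 : ℝ) ≤ 1 / 2 by norm_num) (by norm_num)
  simp only [smul_eq_mul] at h
  rw [huv]
  have h1 := le_famMax (fun j => Real.exp (2 * c * ∑ i, sgn (σ i) * (g j (p i).2 - 1 / 2))) j
  have h2 := le_famMax (fun j => Real.exp (2 * c * ∑ i, sgn (!σ i) * (g j (p i).1 - 1 / 2))) j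
  simp only [radProc]
  linarith

variable [MeasurableSpace 𝒳] (μ : Measure 𝒳) [IsProbabilityMeasure μ]

variable {μ} in
lemma integrable_symProc {g : ι → 𝒳 → ℝ} (hg : ∀ j, Measurable (g j))
    (hg1 : ∀ j x, g j x ∈ Set.Icc (0 : ℝ) 1) {c : ℝ} (hc : 0 ≤ c) (σ : Fin N → Bool)
    (ν : Measure (Fin N → 𝒳 × 𝒳)) [IsFiniteMeasure ν] : Integrable (symProc g c σ) ν :=
  integrable_famMax_exp (c := c * N) (fun j => by
    have := hg j; fun_prop) fun _ _ => mul_sum_sgn_le hc _ _ fun _ =>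
      abs_sub_le_one_of_mem_Icc (hg1 _ _) (hg1 _ _)

/-- Swapping the coordinates of a double sample according to signs does not change the law. -/
lemma integral_symProc (g : ι → 𝒳 → ℝ) (c : ℝ) (σ : Fin N → Bool) :
    ∫ p, symProc g c σ p ∂(Measure.pi fun _ : Fin N => μ.prod μ) =
      ∫ p, symProc g c (fun _ => true) p ∂(Measure.pi fun _ : Fin N => μ.prod μ) := by
  have hid : MeasurePreserving (MeasurableEquiv.refl (𝒳 × 𝒳)) (μ.prod μ) (μ.prod μ) :=
    MeasurePreserving.id _
  have hsw : MeasurePreserving (MeasurableEquiv.prodComm (α := 𝒳) (β := 𝒳))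
    (μ.prod μ) (μ.prod μ) := Measure.measurePreserving_swap
  -- A negative sign is realized by exchanging the two points of the pair, which preserves `μ.prod
  -- μ`.
  let e : Fin N → (𝒳 × 𝒳 ≃ᵐ 𝒳 × 𝒳) := fun i =>
    if σ i then MeasurableEquiv.refl _ else MeasurableEquiv.prodComm
  have he : ∀ i, MeasurePreserving (e i) (μ.prod μ) (μ.prod μ) := by
    intro i
    by_cases h : σ i
    · simpa only [e, h, if_true] using hid
    · simpa only [e, h, Bool.false_eq_true, if_false] using hsw
  have hmp := measurePreserving_pi (fun _ : Fin N => μ.prod μ) (fun _ => μ.prod μ) he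
  have hemb : MeasurableEmbedding fun (a : Fin N → 𝒳 × 𝒳) i => e i (a i) :=
    (MeasurableEquiv.piCongrRight e).measurableEmbedding
  rw [← hmp.integral_comp hemb]
  refine integral_congr_ae (Filter.Eventually.of_forall fun p => ?_)
  simp only [symProc]
  congr 1
  ext j
  congr 2
  refine Finset.sum_congr rfl fun i _ => ?_
  cases h : σ i
  · simp [e, h, sgn, MeasurableEquiv.prodComm]
  · simp [e, h, sgn]

-- The integral does not depend on the signs, so it can be averaged over them; each half of the
-- double sample has the law of a single sample, and flipped signs have the same average.
variable {μ} in
lemma integral_symProc_le {g : ι → 𝒳 → ℝ} (hg : ∀ j, Measurable (g j))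
    (hg1 : ∀ j x, g j x ∈ Set.Icc (0 : ℝ) 1) {c : ℝ} (hc : 0 ≤ c) {a : ℝ}
    (ha : ∀ᵐ z ∂(Measure.pi fun _ : Fin N => μ), 𝔼 σ, radProc g (2 * c) σ z ≤ a) :
    ∫ p, symProc g c (fun _ => true) p ∂(Measure.pi fun _ : Fin N => μ.prod μ) ≤ a := by
  set ν := Measure.pi fun _ : Fin N => μ.prod μ with hν
  have h1 : ∫ p, symProc g c (fun _ => true) p ∂ν = ∫ p, 𝔼 σ, symProc g c σ p ∂ν := by
    simp_rw [Finset.expect_eq_sum_div_card]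
    rw [integral_div, integral_finsetSum _ fun σ _ => integrable_symProc hg hg1 hc σ ν]
    simp_rw [hν, integral_symProc μ g c]
    simp
  have hfst := measurePreserving_pi (fun _ : Fin N => μ.prod μ) (fun _ => μ)
    fun _ => (measurePreserving_fst : MeasurePreserving Prod.fst (μ.prod μ) μ)
  have hsnd := measurePreserving_pi (fun _ : Fin N => μ.prod μ) (fun _ => μ)
    fun _ => (measurePreserving_snd : MeasurePreserving Prod.snd (μ.prod μ) μ)
  have hint : Integrable (fun p => 𝔼 σ, symProc g c σ p) ν := by
    simp_rw [Finset.expect_eq_sum_div_card]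
    exact (integrable_finsetSum _ fun σ _ => integrable_symProc hg hg1 hc σ ν).div_const _
  rw [h1]
  calc _ ≤ ∫ _p, a ∂ν := by
        refine integral_mono_ae hint (integrable_const _) ?_
        filter_upwards [hfst.quasiMeasurePreserving.ae ha, hsnd.quasiMeasurePreserving.ae ha]
          with p hp1 hp2
        calc _ ≤ 𝔼 σ : Fin N → Bool, (radProc g (2 * c) σ (fun i => (p i).2)
              + radProc g (2 * c) (fun i => !σ i) (fun i => (p i).1)) / 2 :=
              Finset.expect_le_expect fun σ _ => symProc_le g c σ p
          _ = (𝔼 σ, radProc g (2 * c) σ (fun i => (p i).2)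
              + 𝔼 σ, radProc g (2 * c) σ (fun i => (p i).1)) / 2 := by
              rw [← Finset.expect_div, Finset.expect_add_distrib,
                expect_flip fun σ => radProc g (2 * c) σ (fun i => (p i).1)]
          _ ≤ a := by linarith
    _ = a := by simp

variable {μ} in
/-- Jensen's inequality for the ghost sample. -/
lemma famMax_exp_le_integral (hN : 0 < N) {g : ι → 𝒳 → ℝ} (hg : ∀ j, Measurable (g j))
    (hg1 : ∀ j x, g j x ∈ Set.Icc (0 : ℝ) 1) {c : ℝ} (hc : 0 ≤ c) (z : Fin N → 𝒳) :
    (famMax fun j => Real.exp (c * N * (∫ x, g j x ∂μ - (∑ i, g j (z i)) / N))) ≤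
      ∫ z', symProc g c (fun _ => true) (fun i => (z i, z' i))
        ∂(Measure.pi fun _ : Fin N => μ) := by
  have hN' : (N : ℝ) ≠ 0 := by positivity
  set ν := Measure.pi fun _ : Fin N => μ with hν
  have hgi : ∀ j i, Integrable (fun z' : Fin N → 𝒳 => g j (z' i)) ν := fun j i =>
    Integrable.of_bound
      ((hg j).comp (measurable_pi_apply i)).aestronglyMeasurable 1 (Filter.Eventually.of_forall fun z' => by
      rw [Real.norm_eq_abs, abs_le]; constructor <;> linarith [(hg1 j (z' i)).1, (hg1 j (z' i)).2])
  have hgv : ∀ j i, ∫ z' : Fin N → 𝒳, g j (z' i) ∂ν = ∫ x, g j x ∂μ := fun j i => by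
    have h := (measurePreserving_eval (fun _ : Fin N => μ) i)
    rw [← h.map_eq, integral_map h.aemeasurable (hg j).aestronglyMeasurable]
  refine famMax_le fun j => ?_
  let f : (Fin N → 𝒳) → ℝ := fun z' => c * ∑ i, (g j (z' i) - g j (z i))
  have hfi : Integrable f ν :=
    (integrable_finsetSum _ fun i _ => (hgi j i).sub (integrable_const _)).const_mul c
  have hfm : Measurable f := by have := hg j; fun_prop
  have hfle : ∀ z', f z' ≤ c * N := fun z' => by
    have := mul_sum_sgn_le hc (fun _ : Fin N => true) (fun i => g j (z' i) - g j (z i))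
      fun _ => abs_sub_le_one_of_mem_Icc (hg1 _ _) (hg1 _ _)
    simpa only [sgn, if_true, one_mul] using this
  have hfv : ∫ z', f z' ∂ν = c * N * (∫ x, g j x ∂μ - (∑ i, g j (z i)) / N) := by
    simp only [f]
    have hi : ∀ i ∈ (Finset.univ : Finset (Fin N)),
        Integrable (fun z' : Fin N → 𝒳 => g j (z' i) - g j (z i)) ν :=
      fun i _ => (hgi j i).sub (integrable_const _)
    rw [integral_const_mul, integral_finsetSum _ hi]
    simp_rw [integral_sub (hgi j _) (integrable_const _), hgv]
    simp only [integral_const, probReal_univ, smul_eq_mul, one_mul, Finset.sum_sub_distrib,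
      Finset.sum_const, Finset.card_univ, Fintype.card_fin, nsmul_eq_mul]
    field_simp
  have hexp : Integrable (Real.exp ∘ f) ν :=
    Integrable.of_bound (hfm.exp).aestronglyMeasurable (Real.exp (c * N))
      (Filter.Eventually.of_forall fun z' => by
        simp only [Function.comp, Real.norm_eq_abs, Real.abs_exp]
        exact Real.exp_le_exp.2 (hfle z'))
  rw [← hfv]
  calc _ ≤ ∫ z', Real.exp (f z') ∂ν :=
        convexOn_exp.map_integral_le Real.continuous_exp.continuousOn isClosed_univ
          (Filter.Eventually.of_forall fun _ => Set.mem_univ _) hfi hexp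
    _ ≤ _ := by
        refine integral_mono hexp ?_ fun z' => ?_
        · exact integrable_famMax_exp (c := c * N) (fun j => by
            have := hg j; fun_prop) fun _ _ => mul_sum_sgn_le hc _ _ fun _ =>
              abs_sub_le_one_of_mem_Icc (hg1 _ _) (hg1 _ _)
        · have := le_famMax (fun j => Real.exp
            (c * ∑ i, sgn true * (g j (z' i) - g j (z i)))) j
          simpa [symProc, sgn, f] using this

variable {μ} in
/-- Exponential-moment symmetrization: a bound for the Rademacher process at almost every sample
bounds the one-sided deviations of the class. -/
lemma measure_exists_deviation_le (hN : 0 < N) {g : ι → 𝒳 → ℝ} (hg : ∀ j, Measurable (g j))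
    (hg1 : ∀ j x, g j x ∈ Set.Icc (0 : ℝ) 1) {c : ℝ} (hc : 0 ≤ c) {a : ℝ}
    (ha : ∀ᵐ z ∂(Measure.pi fun _ : Fin N => μ), 𝔼 σ, radProc g (2 * c) σ z ≤ Real.exp a) (t : ℝ) :
    (Measure.pi fun _ : Fin N => μ).real
      {z | ∃ j, t ≤ ∫ x, g j x ∂μ - (∑ i, g j (z i)) / N} ≤ Real.exp (a - c * N * t) := by
  set ν := Measure.pi fun _ : Fin N => μ with hν
  set F : (Fin N → 𝒳) → ℝ := fun z =>
    famMax fun j => Real.exp (c * N * (∫ x, g j x ∂μ - (∑ i, g j (z i)) / N)) with hF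
  have hI1 : ∀ j, ∫ x, g j x ∂μ ≤ 1 := fun j => by
    calc _ ≤ ∫ _x, (1 : ℝ) ∂μ := integral_mono_of_nonneg
          (Filter.Eventually.of_forall fun x => (hg1 j x).1) (integrable_const _)
          (Filter.Eventually.of_forall fun x => (hg1 j x).2)
      _ = 1 := by simp
  have hFi : Integrable F ν := by
    refine integrable_famMax_exp (c := c * N * 1) (fun j => by have := hg j; fun_prop) ?_
    intro z j
    gcongr
    have : 0 ≤ (∑ i, g j (z i)) / N := by
      have := Finset.sum_nonneg fun i (_ : i ∈ Finset.univ) => (hg1 j (z i)).1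
      positivity
    linarith [hI1 j]
  have hF0 : ∀ z, 0 ≤ F z := fun z => by
    obtain ⟨j⟩ := ‹Nonempty ι›
    exact (Real.exp_pos _).le.trans (le_famMax (fun j => Real.exp
      (c * N * (∫ x, g j x ∂μ - (∑ i, g j (z i)) / N))) j)
  have hmp := measurePreserving_arrowProdEquivProdArrow 𝒳 𝒳 (Fin N) (fun _ => μ) (fun _ => μ)
  have hS := integrable_symProc hg hg1 hc (fun _ : Fin N => true)
    (Measure.pi fun _ : Fin N => μ.prod μ)
  let S : (Fin N → 𝒳) × (Fin N → 𝒳) → ℝ := fun q =>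
    symProc g c (fun _ => true) fun i => (q.1 i, q.2 i)
  have hSi : Integrable S (ν.prod ν) := by
    rw [← hmp.integrable_comp_emb (MeasurableEquiv.measurableEmbedding _)]
    exact hS
  have hFint : ∫ z, F z ∂ν ≤ Real.exp a := by
    calc _ ≤ ∫ z, ∫ z', S (z, z') ∂ν ∂ν :=
          integral_mono hFi hSi.integral_prod_left fun z => famMax_exp_le_integral hN hg hg1 hc z
      _ = ∫ q, S q ∂(ν.prod ν) := (integral_prod _ hSi).symm
      _ = ∫ p, symProc g c (fun _ => true) p ∂(Measure.pi fun _ : Fin N => μ.prod μ) := by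
          rw [← hmp.integral_comp (MeasurableEquiv.measurableEmbedding _)]
          rfl
      _ ≤ _ := integral_symProc_le hg hg1 hc ha
  have hmk := mul_meas_ge_le_integral_of_nonneg (Filter.Eventually.of_forall hF0) hFi
    (Real.exp (c * N * t))
  have hsub : ν.real {z | ∃ j, t ≤ ∫ x, g j x ∂μ - (∑ i, g j (z i)) / N} ≤
      ν.real {z | Real.exp (c * N * t) ≤ F z} := by
    refine measureReal_mono ?_
    rintro z ⟨j, hj⟩
    refine le_trans (Real.exp_le_exp.2 ?_) (le_famMax (fun j => Real.exp
      (c * N * (∫ x, g j x ∂μ - (∑ i, g j (z i)) / N))) j)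
    gcongr
  rw [sub_eq_add_neg, Real.exp_add, Real.exp_neg, ← div_eq_mul_inv, le_div_iff₀ (Real.exp_pos _)]
  calc _ ≤ ν.real {z | Real.exp (c * N * t) ≤ F z} * Real.exp (c * N * t) := by gcongr
    _ = Real.exp (c * N * t) * ν.real {z | Real.exp (c * N * t) ≤ F z} := mul_comm _ _
    _ ≤ _ := hmk.trans hFint

end symm

/-! ### Uniform deviations -/

section deviation

variable {𝒳 : Type*} [MeasurableSpace 𝒳] {μ : Measure 𝒳} [IsProbabilityMeasure μ]
  {Ω : Type*} [MeasurableSpace Ω] {P : Measure Ω} [IsProbabilityMeasure P] {N : ℕ}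
  {Z : Fin N → Ω → 𝒳}

omit [IsProbabilityMeasure μ] in
lemma hasLaw_sample (hlaw : ∀ i, HasLaw (Z i) μ P) (hindep : iIndepFun Z P) :
    HasLaw (fun ω i => Z i ω) (Measure.pi fun _ : Fin N => μ) P where
  aemeasurable := aemeasurable_pi_lambda _ fun i => (hlaw i).aemeasurable
  map_eq := by
    rw [(iIndepFun_iff_map_fun_eq_pi_map fun i => (hlaw i).aemeasurable).1 hindep]
    congr 1
    ext1 i
    exact (hlaw i).map_eq

omit [IsProbabilityMeasure μ] [IsProbabilityMeasure P] in
lemma ae_forall_sample (hlaw : ∀ i, HasLaw (Z i) μ P) {p : 𝒳 → Prop} (hp : ∀ᵐ x ∂μ, p x) :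
    ∀ᵐ ω ∂P, ∀ i, p (Z i ω) := by
  rw [ae_all_iff]
  intro i
  exact ae_of_ae_map (hlaw i).aemeasurable (by rw [(hlaw i).map_eq]; exact hp)

/-- For a finite measurable family the events involved are measurable in the sample, so they
transfer between `P` and the product measure. -/
lemma sample_deviation_le (hN : 0 < N) (hlaw : ∀ i, HasLaw (Z i) μ P) (hindep : iIndepFun Z P)
    {ι : Type*} [Fintype ι] [Nonempty ι] {g : ι → 𝒳 → ℝ} (hg : ∀ j, Measurable (g j))
    (hg1 : ∀ j x, g j x ∈ Set.Icc (0 : ℝ) 1) {c : ℝ} (hc : 0 ≤ c) {a : ℝ}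
    (ha : ∀ᵐ ω ∂P, 𝔼 σ, radProc g (2 * c) σ (fun i => Z i ω) ≤ Real.exp a) (t : ℝ) :
    P {ω | ∃ j, t ≤ ∫ x, g j x ∂μ - (∑ i, g j (Z i ω)) / N} ≤
      ENNReal.ofReal (Real.exp (a - c * N * t)) := by
  have hZ := hasLaw_sample hlaw hindep
  have hmeas : MeasurableSet {z : Fin N → 𝒳 | 𝔼 σ, radProc g (2 * c) σ z ≤ Real.exp a} := by
    refine measurableSet_le ?_ measurable_const
    simp_rw [Finset.expect_eq_sum_div_card]
    refine (Finset.measurable_sum _ fun σ _ => ?_).div_const _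
    exact measurable_famMax fun j => by have := hg j; fun_prop
  have ha' : ∀ᵐ z ∂(Measure.pi fun _ : Fin N => μ), 𝔼 σ, radProc g (2 * c) σ z ≤ Real.exp a := by
    rw [← hZ.map_eq, ae_map_iff hZ.aemeasurable hmeas]
    exact ha
  have hset : MeasurableSet {z : Fin N → 𝒳 | ∃ j, t ≤ ∫ x, g j x ∂μ - (∑ i, g j (z i)) / N} := by
    rw [Set.ofPred_exists]
    refine MeasurableSet.iUnion fun j => measurableSet_le measurable_const ?_
    have := hg j
    fun_prop
  have h := hZ.measure_eq hset
  rw [h, ← ofReal_measureReal]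
  exact ENNReal.ofReal_le_ofReal (measure_exists_deviation_le hN hg hg1 hc ha' t)

-- Centring at `1 / 2` bounds each coefficient `2 * c * (g - 1 / 2)` by `c` in absolute value, which
-- gives the Hoeffding constant used below.
omit [MeasurableSpace 𝒳] in
lemma expect_radProc_single_le {g : 𝒳 → ℝ} (hg1 : ∀ x, g x ∈ Set.Icc (0 : ℝ) 1) (c : ℝ)
    (z : Fin N → 𝒳) :
    𝔼 σ, radProc (fun _ : Unit => g) (2 * c) σ z ≤ Real.exp (N * c ^ 2 / 2) := by
  have h1 : ∀ σ : Fin N → Bool, radProc (fun _ : Unit => g) (2 * c) σ z =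
      Real.exp (∑ i, sgn (σ i) * (2 * c * (g (z i) - 1 / 2))) := by
    intro σ
    simp only [radProc, famMax, Finset.sup'_const]
    rw [Finset.mul_sum]
    congr 1
    exact Finset.sum_congr rfl fun i _ => by ring
  simp_rw [h1]
  refine (expect_exp_sum_sgn_le _).trans (Real.exp_le_exp.2 ?_)
  gcongr
  calc _ ≤ ∑ _i : Fin N, c ^ 2 := Finset.sum_le_sum fun i _ => by
        have hx := hg1 (z i)
        have : (g (z i) - 1 / 2) ^ 2 ≤ 1 / 4 := by nlinarith [hx.1, hx.2]
        rw [mul_pow, mul_pow]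
        nlinarith [sq_nonneg c]
    _ = N * c ^ 2 := by simp

omit [MeasurableSpace 𝒳] in
lemma dist_empVec (z : Fin N → 𝒳) (f g : 𝒳 → ℝ) :
    dist (empVec z f) (empVec z g) = Real.sqrt ((∑ i, (f (z i) - g (z i)) ^ 2) / N) := by
  rw [EuclideanSpace.dist_eq]
  congr 1
  rw [Finset.sum_div]
  refine Finset.sum_congr rfl fun i _ => ?_
  simp only [empVec]
  rw [Real.dist_eq, sq_abs, ← sub_div, div_pow, Real.sq_sqrt (by positivity)]

-- `empVec` carries a factor `1 / √N`, so the chaining parameter is `s = 2 * c * √N`; values in `[0,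
-- 1]` lie within `1 / 2` of the constant centre.
omit [MeasurableSpace 𝒳] in
lemma expect_radProc_le (hN : 0 < N) {ι : Type*} [Fintype ι] [Nonempty ι] {g : ι → 𝒳 → ℝ}
    (hg1 : ∀ j x, g j x ∈ Set.Icc (0 : ℝ) 1) {c : ℝ} (hc : 0 ≤ c) (z : Fin N → 𝒳) (m : ℕ) (A : ℝ)
    (hA : 1 ≤ A) (hcov : EntropyGrowth z m A (Set.range g)) :
    𝔼 σ, radProc g (2 * c) σ z ≤ Real.exp (2 * c * Real.sqrt N + 10 * m * A
      + (2 * c * Real.sqrt N) ^ 2 / 2) := by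
  have hN' : (0 : ℝ) < N := by exact_mod_cast hN
  obtain ⟨G, hG1, hG⟩ := exists_entropy_majorant (empVec z '' Set.range g)
    (empVec z fun _ => 1 / 2) m A hA (by
      rintro _ ⟨_, ⟨j, rfl⟩, rfl⟩
      rw [dist_empVec, Real.sqrt_le_left (by norm_num), div_le_iff₀ hN']
      calc _ ≤ ∑ _i : Fin N, (1 / 4 : ℝ) := Finset.sum_le_sum fun i _ => by
            have hx := hg1 j (z i)
            nlinarith [hx.1, hx.2]
        _ = (1 / 2) ^ 2 * N := by simp; ring) hcov (2 * c * Real.sqrt N) (by positivity)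
  set a := 2 * c * Real.sqrt N + 10 * m * A + (2 * c * Real.sqrt N) ^ 2 / 2 with ha
  have h1 : ∀ σ, radProc g (2 * c) σ z ≤ Real.exp a * G σ := by
    intro σ
    refine famMax_le fun j => ?_
    have h := hG σ (empVec z (g j)) ⟨_, ⟨j, rfl⟩, rfl⟩
    have h2 : 2 * c * Real.sqrt N * ∑ i, sgn (σ i) * ((empVec z (g j)) i
        - (empVec z fun _ => 1 / 2) i) = 2 * c * ∑ i, sgn (σ i) * (g j (z i) - 1 / 2) := by
      rw [mul_assoc, Finset.mul_sum]
      congr 1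
      refine Finset.sum_congr rfl fun i _ => ?_
      have : Real.sqrt N ≠ 0 := by positivity
      simp only [empVec]
      field_simp
    rw [h2] at h
    calc _ = Real.exp a * Real.exp (2 * c * ∑ i, sgn (σ i) * (g j (z i) - 1 / 2) - a) := by
          rw [← Real.exp_add]; ring_nf
      _ ≤ _ := by gcongr
  calc _ ≤ 𝔼 σ, Real.exp a * G σ := Finset.expect_le_expect fun σ _ => h1 σ
    _ = Real.exp a * 𝔼 σ, G σ := (Finset.mul_expect _ _ _).symm
    _ ≤ Real.exp a * 1 := by gcongr
    _ = _ := mul_one _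

/-- Truncation of a real number to `[0, 1]`. -/
def clip (x : ℝ) : ℝ := max 0 (min 1 x)

lemma clip_mem (x : ℝ) : clip x ∈ Set.Icc (0 : ℝ) 1 :=
  ⟨le_max_left _ _, max_le zero_le_one (min_le_left _ _)⟩

lemma clip_eq {x : ℝ} (hx : x ∈ Set.Icc (0 : ℝ) 1) : clip x = x := by
  rw [clip, min_eq_right hx.2, max_eq_right hx.1]

lemma measurable_clip : Measurable clip := by unfold clip; fun_prop

/-- One-sided deviation bound for a single bounded function. -/
lemma single_deviation_le (hN : 0 < N) (hlaw : ∀ i, HasLaw (Z i) μ P) (hindep : iIndepFun Z P)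
    {f : 𝒳 → ℝ} (hf : Measurable f) (hf1 : ∀ᵐ x ∂μ, f x ∈ Set.Icc (0 : ℝ) 1)
    {r : ℝ} (hr : 0 ≤ r) :
    P {ω | (∑ i, f (Z i ω)) / N + Real.sqrt (2 * r / N) ≤ ∫ x, f x ∂μ} ≤
      ENNReal.ofReal (Real.exp (-r)) := by
  have hN' : (0 : ℝ) < N := by exact_mod_cast hN
  set t := Real.sqrt (2 * r / N) with ht
  -- Clipping turns an almost sure bound into an everywhere bound. The choice `c = t` minimizes the
  -- exponent `N * c ^ 2 / 2 - c * N * t`.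
  have h := sample_deviation_le hN hlaw hindep (g := fun _ : Unit => fun x => clip (f x))
    (fun _ => measurable_clip.comp hf) (fun _ x => clip_mem _) (Real.sqrt_nonneg _ : 0 ≤ t)
    (Filter.Eventually.of_forall fun ω =>
      expect_radProc_single_le (fun x => clip_mem (f x)) t fun i => Z i ω) t
  have hexp : N * t ^ 2 / 2 - t * N * t = -r := by
    have : t ^ 2 = 2 * r / N := Real.sq_sqrt (by positivity)
    have h2 : N * t ^ 2 / 2 - t * N * t = -(N * t ^ 2 / 2) := by ring
    rw [h2, this]; field_simp
  rw [hexp] at h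
  have hint : ∫ x, clip (f x) ∂μ = ∫ x, f x ∂μ :=
    integral_congr_ae (hf1.mono fun x hx => clip_eq hx)
  refine (measure_mono_ae ?_).trans h
  filter_upwards [ae_forall_sample hlaw hf1] with ω hω hbad
  refine ⟨(), ?_⟩
  have hs : ∑ i, clip (f (Z i ω)) = ∑ i, f (Z i ω) :=
    Finset.sum_congr rfl fun i _ => clip_eq (hω i)
  simp only [hint, hs]
  have hbad' : (∑ i, f (Z i ω)) / N + t ≤ ∫ x, f x ∂μ := hbad
  linarith

omit [IsProbabilityMeasure μ] in
/-- A Lipschitz-parameterized class has finite nets that are uniformly good at almost every point. -/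
lemma HasLipschitzParam.exists_finite_net {m : ℕ} {G : Set (𝒳 → ℝ)} (h : HasLipschitzParam μ m G)
    {η : ℝ} (hη : 0 < η) :
    ∃ (F : Set (𝒳 → ℝ)) (π : (𝒳 → ℝ) → 𝒳 → ℝ), F.Finite ∧ F ⊆ G ∧ (∀ f ∈ G, π f ∈ F) ∧
      ∀ᵐ x ∂μ, ∀ f ∈ G, |f x - π f x| ≤ η := by
  obtain ⟨Θ, Φ, K, hΘ, rfl, hL⟩ := h
  -- `|K| + 1` keeps the radius positive whatever the sign of `K`.
  have hr : 0 < η / (|K| + 1) := by positivity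
  obtain ⟨C, hCΘ, hCf, hC⟩ := Metric.finite_approx_of_totallyBounded 
    (hΘ.isCompact_closure.totallyBounded.subset subset_closure) _ hr
  have hex : ∀ f : 𝒳 → ℝ, ∃ c, f ∈ Φ '' Θ → c ∈ C ∧ ∃ θ ∈ Θ, Φ θ = f ∧
      dist θ c ≤ η / (|K| + 1) := by
    intro f
    by_cases hf : f ∈ Φ '' Θ
    · obtain ⟨θ, hθ, rfl⟩ := hf
      obtain ⟨c, hc, hd⟩ := Set.mem_iUnion₂.1 (hC hθ)
      exact ⟨c, fun _ => ⟨hc, θ, hθ, rfl, (Metric.mem_ball.1 hd).le⟩⟩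
    · exact ⟨0, fun h => absurd h hf⟩
  choose c hc using hex
  refine ⟨Φ '' C, fun f => Φ (c f), hCf.image _, Set.image_mono hCΘ,
    fun f hf => ⟨_, (hc f hf).1, rfl⟩, ?_⟩
  filter_upwards [hL] with x hx f hf
  obtain ⟨hcC, θ, hθ, hθf, hd⟩ := hc f hf
  have h1 := hx θ hθ _ (hCΘ hcC)
  rw [hθf] at h1
  calc _ ≤ K * dist θ (c f) := h1
    _ ≤ (|K| + 1) * (η / (|K| + 1)) := by
        gcongr
        linarith [le_abs_self K]
    _ = η := by field_simp

-- External covering numbers are monotone because centres need not lie in the set. Inclusion is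
-- asked only of sample vectors, so that clipped functions are allowed; nonemptiness keeps the
-- argument of the logarithm positive.
omit [MeasurableSpace 𝒳] in
lemma EntropyGrowth.mono {z : Fin N → 𝒳} {m : ℕ} {A : ℝ} {F G : Set (𝒳 → ℝ)}
    (h : EntropyGrowth z m A G) (hF : F.Nonempty) (hFG : empVec z '' F ⊆ empVec z '' G) :
    EntropyGrowth z m A F := by
  intro ε hε hε1
  obtain ⟨h1, h2⟩ := h ε hε hε1
  have hle : empCoveringNumber z ε F ≤ empCoveringNumber z ε G :=
    Metric.externalCoveringNumber_mono_set hFG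
  have h3 : empCoveringNumber z ε F ≠ ⊤ := ne_top_of_le_ne_top h1 hle
  have h4 : empCoveringNumber z ε F ≠ 0 := by
    rw [empCoveringNumber, Ne, Metric.externalCoveringNumber_eq_zero]
    exact (hF.image _).ne_empty
  refine ⟨h3, le_trans (Real.log_le_log ?_ ?_) h2⟩
  · have : (empCoveringNumber z ε F).toNat ≠ 0 := by
      rw [Ne, ENat.toNat_eq_zero]; tauto
    exact_mod_cast Nat.pos_of_ne_zero this
  · exact_mod_cast ENat.toNat_le_toNat hle h1

/-- Uniform one-sided deviation bound for a Lipschitz-parameterized class of polynomial entropy. -/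
lemma uniform_deviation_le (hN : 0 < N) (hlaw : ∀ i, HasLaw (Z i) μ P) (hindep : iIndepFun Z P)
    {m : ℕ} {A : ℝ} (hA : 1 ≤ A) {G : Set (𝒳 → ℝ)} (hG : ∀ f ∈ G, Measurable f)
    (hG1 : ∀ᵐ x ∂μ, ∀ f ∈ G, f x ∈ Set.Icc (0 : ℝ) 1) (hpar : HasLipschitzParam μ m G)
    (hcov : ∀ᵐ ω ∂P, EntropyGrowth (fun i => Z i ω) m A G) {r : ℝ} (hr : 0 ≤ r) :
    P {ω | ∃ f ∈ G, (∑ i, f (Z i ω)) / N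
        + (2 * Real.sqrt (2 * (10 * m * A + r)) + 4) / Real.sqrt N ≤ ∫ x, f x ∂μ} ≤
      ENNReal.ofReal (Real.exp (-r)) := by
  have hN' : (0 : ℝ) < N := by exact_mod_cast hN
  have hsN : 0 < Real.sqrt N := Real.sqrt_pos.2 hN'
  rcases G.eq_empty_or_nonempty with rfl | ⟨f₀, hf₀⟩
  · simp
  obtain ⟨F, π, hFf, hFG, hπF, hπ⟩ := hpar.exists_finite_net (show 0 < 1 / Real.sqrt N by positivity)
  have hFne : F.Nonempty := ⟨π f₀, hπF f₀ hf₀⟩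
  have : Fintype F := hFf.fintype
  have : Nonempty F := hFne.to_subtype
  set g : F → 𝒳 → ℝ := fun j x => clip (j.1 x) with hg
  -- With `c = s / (2 * √N)` and `t = 2 * (s + 1) / √N`, the product `c * N * t` is `s * (s + 1)`.
  -- The exponent becomes `10 * m * A - s ^ 2 / 2`, and this `s` makes it `-r`.
  set s := Real.sqrt (2 * (10 * m * A + r)) with hs
  set t := 2 * (s + 1) / Real.sqrt N with ht
  have hs0 : 0 ≤ s := Real.sqrt_nonneg _
  have hfm : ∀ f ∈ G, Integrable f μ := fun f hf =>
    Integrable.of_bound (hG f hf).aestronglyMeasurable 1 (hG1.mono fun x hx => by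
      rw [Real.norm_eq_abs, abs_le]; constructor <;> linarith [(hx f hf).1, (hx f hf).2])
  have ha : ∀ᵐ ω ∂P, 𝔼 σ, radProc g (2 * (s / (2 * Real.sqrt N))) σ (fun i => Z i ω) ≤
      Real.exp (s + 10 * m * A + s ^ 2 / 2) := by
    filter_upwards [hcov, ae_forall_sample hlaw hG1] with ω hω hω1
    have hE : EntropyGrowth (fun i => Z i ω) m A (Set.range g) := by
      refine hω.mono (Set.range_nonempty g) ?_
      rintro _ ⟨_, ⟨j, rfl⟩, rfl⟩
      refine ⟨j.1, hFG j.2, ?_⟩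
      simp only [empVec, hg]
      congr 1
      ext i
      rw [clip_eq (hω1 i _ (hFG j.2))]
    have h := expect_radProc_le (g := g) hN (fun j x => clip_mem _)
      (show 0 ≤ s / (2 * Real.sqrt N) by positivity) (fun i => Z i ω) m A hA hE
    have h2 : 2 * (s / (2 * Real.sqrt N)) * Real.sqrt N = s := by field_simp
    rwa [h2] at h
  have hgm : ∀ j, Measurable (g j) := fun j => measurable_clip.comp (hG j.1 (hFG j.2))
  have hgI : ∀ j x, g j x ∈ Set.Icc (0 : ℝ) 1 := fun j x => clip_mem _
  have hc : 0 ≤ s / (2 * Real.sqrt N) := by positivity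
  have h := sample_deviation_le hN hlaw hindep hgm hgI hc ha t
  have hexp : s + 10 * m * A + s ^ 2 / 2 - s / (2 * Real.sqrt N) * N * t = -r := by
    have h1 : s ^ 2 = 2 * (10 * m * A + r) := Real.sq_sqrt (by positivity)
    have h2 : s / (2 * Real.sqrt N) * N * t = s * (s + 1) := by
      rw [ht]
      have : (N : ℝ) = Real.sqrt N * Real.sqrt N := (Real.mul_self_sqrt hN'.le).symm
      rw [show s / (2 * Real.sqrt N) * N * (2 * (s + 1) / Real.sqrt N) =
        s * (s + 1) * (N / (Real.sqrt N * Real.sqrt N)) by field_simp, ← this, div_self hN'.ne',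
        mul_one]
    rw [h2]
    linarith
  rw [hexp] at h
  refine (measure_mono_ae ?_).trans h
  filter_upwards [ae_forall_sample hlaw hG1, ae_forall_sample hlaw hπ] with ω hω1 hωπ hbad
  obtain ⟨f, hf, hfb⟩ := hbad
  have hπG := hFG (hπF f hf)
  refine ⟨⟨π f, hπF f hf⟩, ?_⟩
  have hI : ∫ x, g ⟨π f, hπF f hf⟩ x ∂μ = ∫ x, π f x ∂μ :=
    integral_congr_ae (hG1.mono fun x hx => clip_eq (hx _ hπG))
  have hS : ∑ i, g ⟨π f, hπF f hf⟩ (Z i ω) = ∑ i, π f (Z i ω) :=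
    Finset.sum_congr rfl fun i _ => clip_eq (hω1 i _ hπG)
  change t ≤ ∫ x, g ⟨π f, hπF f hf⟩ x ∂μ - (∑ i, g ⟨π f, hπF f hf⟩ (Z i ω)) / N
  rw [hI, hS]
  have h1 : ∫ x, f x ∂μ ≤ ∫ x, π f x ∂μ + 1 / Real.sqrt N := by
    calc _ ≤ ∫ x, (π f x + 1 / Real.sqrt N) ∂μ := by
          refine integral_mono_ae (hfm f hf) ((hfm _ hπG).add (integrable_const _)) ?_
          filter_upwards [hπ] with x hx
          linarith [(abs_le.1 (hx f hf)).2]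
      _ = _ := by rw [integral_add (hfm _ hπG) (integrable_const _)]; simp
  have h2 : (∑ i, π f (Z i ω)) / N ≤ (∑ i, f (Z i ω)) / N + 1 / Real.sqrt N := by
    rw [div_add' _ _ _ hN'.ne', div_le_div_iff_of_pos_right hN']
    calc _ ≤ ∑ i, (f (Z i ω) + 1 / Real.sqrt N) := Finset.sum_le_sum fun i _ => by
          linarith [(abs_le.1 (hωπ i f hf)).1]
      _ = _ := by rw [Finset.sum_add_distrib]; simp; ring
  -- The net error is paid twice, once in the integral and once in the empirical mean.
  have h3 : (2 * s + 4) / Real.sqrt N = t + 1 / Real.sqrt N + 1 / Real.sqrt N := by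
    rw [ht]; field_simp; ring
  rw [h3] at hfb
  linarith

end deviation

/-! ### The normalized losses -/

section loss

variable {d : ℕ} {B : ℝ}

lemma SupBounded.norm_sub_le (hB : 0 < B) {x y : E d} (hx : SupBounded B x) (hy : SupBounded B y) :
    ‖x - y‖ ≤ 2 * B * Real.sqrt d := by
  rw [EuclideanSpace.norm_eq, Real.sqrt_le_left (by positivity), mul_pow,
    Real.sq_sqrt (by positivity)]
  calc _ ≤ ∑ _i : Fin d, (2 * B) ^ 2 := Finset.sum_le_sum fun i _ => by
        rw [PiLp.sub_apply, Real.norm_eq_abs]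
        gcongr
        exact (abs_sub _ _).trans (by linarith [hx i, hy i])
    _ = (2 * B) ^ 2 * d := by simp; ring

lemma normLoss_mem_Icc (hB : 0 < B) {x y : E d} (hx : SupBounded B x) (hy : SupBounded B y) :
    normLoss B x y ∈ Set.Icc (0 : ℝ) 1 := by
  refine ⟨by unfold normLoss; positivity, div_le_one_of_le₀ ?_ (by positivity)⟩
  calc _ ≤ (2 * B * Real.sqrt d) ^ 2 := by gcongr; exact hx.norm_sub_le hB hy
    _ = 4 * B ^ 2 * d := by rw [mul_pow, Real.sq_sqrt (by positivity)]; ring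

/-- The normalized loss is Lipschitz in the prediction. -/
lemma normLoss_le_add (hd : 0 < d) (hB : 0 < B) {x x' y : E d} (hx : SupBounded B x)
    (hx' : SupBounded B x') (hy : SupBounded B y) :
    normLoss B x y ≤ normLoss B x' y + ‖x - x'‖ / (B * Real.sqrt d) := by
  have hd' : (0 : ℝ) < d := by exact_mod_cast hd
  have hs : Real.sqrt d ^ 2 = d := Real.sq_sqrt hd'.le
  have h1 := hx.norm_sub_le hB hy
  have h2 := hx'.norm_sub_le hB hy
  have h3 : ‖x - y‖ - ‖x' - y‖ ≤ ‖x - x'‖ := by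
    have := norm_sub_norm_le (x - y) (x' - y)
    rwa [sub_sub_sub_cancel_right] at this
  -- Difference of squares, each norm being at most `2 * B * √d`.
  have h4 : ‖x - y‖ ^ 2 ≤ ‖x' - y‖ ^ 2 + ‖x - x'‖ * (4 * B * Real.sqrt d) := by
    have h5 : (‖x - y‖ - ‖x' - y‖) * (‖x - y‖ + ‖x' - y‖) ≤
        ‖x - x'‖ * (‖x - y‖ + ‖x' - y‖) := by gcongr
    have h6 : ‖x - x'‖ * (‖x - y‖ + ‖x' - y‖) ≤ ‖x - x'‖ * (4 * B * Real.sqrt d) := by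
      gcongr; linarith
    nlinarith
  unfold normLoss
  have h7 : ‖x - x'‖ / (B * Real.sqrt d) =
      ‖x - x'‖ * (4 * B * Real.sqrt d) / (4 * B ^ 2 * d) := by
    rw [div_eq_div_iff (by positivity) (by positivity)]
    linear_combination (-(4 * B ^ 2 * ‖x - x'‖)) * hs
  rw [h7, ← add_div]
  gcongr

end loss

/-! ### Measurability of the losses and decoupling of the practical risk -/

section risk

variable {dL dH : ℕ} {B : ℝ}

lemma Sample.measurable_lt : Measurable (Sample.lt : Sample dL dH → E dL) := measurable_fst
lemma Sample.measurable_ht : Measurable (Sample.ht : Sample dL dH → E dH) :=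
  measurable_fst.comp measurable_snd
lemma Sample.measurable_l : Measurable (Sample.l : Sample dL dH → E dL) :=
  measurable_fst.comp (measurable_snd.comp measurable_snd)
lemma Sample.measurable_h : Measurable (Sample.h : Sample dL dH → E dH) :=
  measurable_snd.comp (measurable_snd.comp measurable_snd)

lemma measurable_normLoss {α : Type*} [MeasurableSpace α] {d : ℕ} {f g : α → E d}
    (hf : Measurable f) (hg : Measurable g) : Measurable fun a => normLoss B (f a) (g a) :=
  ((hf.sub hg).norm.pow_const 2).div_const _

lemma measurable_lossL {gL : E dL → E dL} (hgL : Measurable gL) :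
    Measurable (lossL (dH := dH) B gL) :=
  measurable_normLoss (hgL.comp Sample.measurable_lt) Sample.measurable_l

lemma measurable_lossH {gH : E dL × E dH → E dH} (hgH : Measurable gH) :
    Measurable (lossH B gH) :=
  measurable_normLoss (hgH.comp (Sample.measurable_l.prodMk Sample.measurable_ht))
    Sample.measurable_h

lemma measurable_lossHReal {gL : E dL → E dL} {gH : E dL × E dH → E dH} (hgL : Measurable gL)
    (hgH : Measurable gH) : Measurable (lossHReal B gL gH) :=
  measurable_normLoss
    (hgH.comp ((hgL.comp Sample.measurable_lt).prodMk Sample.measurable_ht)) Sample.measurable_h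

lemma integrable_of_ae_mem_Icc {α : Type*} [MeasurableSpace α] {μ : Measure α} [IsFiniteMeasure μ]
    {f : α → ℝ} (hf : Measurable f) (h : ∀ᵐ x ∂μ, f x ∈ Set.Icc (0 : ℝ) 1) : Integrable f μ :=
  Integrable.of_bound hf.aestronglyMeasurable 1 (h.mono fun x hx => by
    rw [Real.norm_eq_abs, abs_le]; constructor <;> linarith [hx.1, hx.2])

/-- Decoupling: the practical risk exceeds the teacher-forced risk by at most the conditioning
error. -/
lemma riskReal_le (hdH : 0 < dH) (hB : 0 < B) {μ : Measure (Sample dL dH)} [IsProbabilityMeasure μ]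
    (hl : ∀ᵐ z ∂μ, SupBounded B (Sample.l z)) (hh : ∀ᵐ z ∂μ, SupBounded B (Sample.h z))
    {gL : E dL → E dL} (hgLm : Measurable gL) (hgLb : ∀ x, SupBounded B (gL x))
    {gH : E dL × E dH → E dH} (hgHm : Measurable gH) (hgHb : ∀ x, SupBounded B (gH x))
    {Lcond : ℝ} (hLip : ∀ x x' y, ‖gH (x, y) - gH (x', y)‖ ≤ Lcond * ‖x - x'‖) :
    riskReal μ B gL gH ≤ ∫ z, lossL B gL z ∂μ + ∫ z, lossH B gH z ∂μ +
      Lcond / (B * Real.sqrt dH) * ∫ z, ‖gL (Sample.lt z) - Sample.l z‖ ∂μ := by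
  have hd' : (0 : ℝ) < dH := by exact_mod_cast hdH
  have hiL : Integrable (lossL B gL) μ := integrable_of_ae_mem_Icc (measurable_lossL hgLm)
    (hl.mono fun z hz => normLoss_mem_Icc hB (hgLb _) hz)
  have hiH : Integrable (lossH B gH) μ := integrable_of_ae_mem_Icc (measurable_lossH hgHm)
    (hh.mono fun z hz => normLoss_mem_Icc hB (hgHb _) hz)
  have hiR : Integrable (lossHReal B gL gH) μ :=
    integrable_of_ae_mem_Icc (measurable_lossHReal hgLm hgHm)
      (hh.mono fun z hz => normLoss_mem_Icc hB (hgHb _) hz)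
  have hiD : Integrable (fun z => ‖gL (Sample.lt z) - Sample.l z‖) μ := by
    refine Integrable.of_bound ((hgLm.comp Sample.measurable_lt).sub
      Sample.measurable_l).norm.aestronglyMeasurable (2 * B * Real.sqrt dL) ?_
    filter_upwards [hl] with z hz
    rw [norm_norm]
    exact (hgLb _).norm_sub_le hB hz
  unfold riskReal
  rw [integral_add hiL hiR, add_assoc, ← integral_const_mul, ← integral_add hiH (hiD.const_mul _)]
  have hiS := hiH.add (hiD.const_mul (Lcond / (B * Real.sqrt dH)))
  refine add_le_add le_rfl (integral_mono_ae hiR hiS ?_)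
  filter_upwards [hh] with z hz
  refine (normLoss_le_add hdH hB (hgHb _) (hgHb (Sample.l z, Sample.ht z)) hz).trans ?_
  refine add_le_add le_rfl ?_
  rw [div_mul_eq_mul_div]
  gcongr
  exact hLip _ _ _

end risk

/-- The complexity term dominates the chaining bound. -/
lemma complexity_bound {d m : ℕ} (hd : 0 < d) {A r : ℝ} (hA : 1 ≤ A) (hr : 0 ≤ r) :
    2 * Real.sqrt (2 * (10 * m * A + r)) + 4 ≤
      12 * A * Real.sqrt Real.pi * (Real.sqrt d + Real.sqrt m) + 2 * Real.sqrt (2 * r) := by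
  have h1 : Real.sqrt (2 * (10 * m * A + r)) ≤ 5 * (A * Real.sqrt m) + Real.sqrt (2 * r) := by
    -- Since `A ≥ 1`, `20 * m * A ≤ 25 * m * A ^ 2`; subadditivity of the square root then splits
    -- off `r`.
    have : 2 * (10 * m * A + r) ≤ (5 * (A * Real.sqrt m)) ^ 2 + 2 * r := by
      have hm : (0 : ℝ) ≤ m := by positivity
      have : (m : ℝ) * A ≤ m * A * A := le_mul_of_one_le_right (by positivity) hA
      rw [mul_pow, mul_pow, Real.sq_sqrt hm]
      nlinarith
    rw [Real.sqrt_le_left (by positivity), add_sq, Real.sq_sqrt (show 0 ≤ 2 * r by positivity)]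
    have : 0 ≤ 2 * (5 * (A * Real.sqrt m)) * Real.sqrt (2 * r) := by positivity
    linarith
  -- The `√d` term of the right-hand side serves to absorb the additive 4.
  have h2 : 1 ≤ Real.sqrt d := Real.one_le_sqrt.2 (by exact_mod_cast hd)
  have h3 : 1 ≤ Real.sqrt Real.pi := Real.one_le_sqrt.2 (by linarith [Real.pi_gt_three])
  have h4 : A ≤ A * Real.sqrt Real.pi := le_mul_of_one_le_right (by linarith) h3
  have h5 : A * 1 ≤ A * Real.sqrt Real.pi * Real.sqrt d := by gcongr
  have h6 : A * Real.sqrt m ≤ A * Real.sqrt Real.pi * Real.sqrt m := by gcongr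
  have h7 : 0 ≤ A * Real.sqrt m := by positivity
  nlinarith

end FreqDecoupling

end

/-! ### Assembly of the risk bound -/

theorem mainTheorem4
    {dL dH kL N : ℕ} (hkL : kL < dL) (hdH : 0 < dH) (hN : 0 < N)
    -- the law of `z = (l_t, h_t, l, h)`
    (μ : Measure (FreqDecoupling.Sample dL dH)) [IsProbabilityMeasure μ]
    -- `N` i.i.d. samples from `μ`
    {Ω : Type*} [MeasurableSpace Ω] (P : Measure Ω) [IsProbabilityMeasure P]
    (Z : Fin N → Ω → FreqDecoupling.Sample dL dH)
    (hlaw : ∀ i, HasLaw (Z i) μ P) (hindep : iIndepFun Z P)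
    -- the two classes of predictors
    (FL : Set (FreqDecoupling.E dL → FreqDecoupling.E dL))
    (FH : Set (FreqDecoupling.E dL × FreqDecoupling.E dH → FreqDecoupling.E dH))
    (hFLm : ∀ g ∈ FL, Measurable g) (hFHm : ∀ g ∈ FH, Measurable g)
    -- boundedness of the clean targets and of the predictions
    (B : ℝ) (hB : 0 < B)
    (hl : ∀ᵐ z ∂μ, FreqDecoupling.SupBounded B (FreqDecoupling.Sample.l z))
    (hh : ∀ᵐ z ∂μ, FreqDecoupling.SupBounded B (FreqDecoupling.Sample.h z))
    (hFLb : ∀ g ∈ FL, ∀ x, FreqDecoupling.SupBounded B (g x))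
    (hFHb : ∀ g ∈ FH, ∀ x, FreqDecoupling.SupBounded B (g x))
    -- finite-dimensional Lipschitz parameterization of the loss classes
    (hparL : FreqDecoupling.HasLipschitzParam μ dL (FreqDecoupling.lossClassL (dH := dH) B FL))
    (hparH : FreqDecoupling.HasLipschitzParam μ (kL + dH) (FreqDecoupling.lossClassH B FH))
    -- covering-number growth
    (A : ℝ) (hA : 1 ≤ A)
    (hcovL : ∀ᵐ ω ∂P, FreqDecoupling.EntropyGrowth (fun i => Z i ω) dL A
      (FreqDecoupling.lossClassL (dH := dH) B FL))
    (hcovH : ∀ᵐ ω ∂P, FreqDecoupling.EntropyGrowth (fun i => Z i ω) (kL + dH) A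
      (FreqDecoupling.lossClassH B FH))
    -- Lipschitz dependence of the high-frequency branch on its conditioning input
    (Lcond : ℝ) (hLcond : 0 < Lcond)
    (hLip : ∀ g ∈ FH, ∀ (x x' : FreqDecoupling.E dL) (y : FreqDecoupling.E dH),
      ‖g (x, y) - g (x', y)‖ ≤ Lcond * ‖x - x'‖)
    -- a fixed low-frequency predictor and a confidence level
    (gL : FreqDecoupling.E dL → FreqDecoupling.E dL) (hgL : gL ∈ FL)
    (δ : ℝ) (hδ0 : 0 < δ) (hδ1 : δ < 1) :
    ∃ S : Set Ω, MeasurableSet S ∧ 1 - δ ≤ P.real S ∧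
      ∀ ω ∈ S, ∀ gH ∈ FH,
        FreqDecoupling.riskReal μ B gL gH ≤
          FreqDecoupling.empRiskDec (fun i => Z i ω) B gL gH
          + 12 * A * Real.sqrt Real.pi / Real.sqrt N * (Real.sqrt dL + Real.sqrt (kL + dH))
          + Lcond / (B * Real.sqrt dH)
            * ∫ z, ‖gL (FreqDecoupling.Sample.lt z) - FreqDecoupling.Sample.l z‖ ∂μ
          + 3 * Real.sqrt (2 * Real.log (8 / δ) / N) := by
  have hdL : 0 < dL := by omega
  have hN' : (0 : ℝ) < N := by exact_mod_cast hN
  -- Two bad events share `δ` equally, so `2 / δ` suffices; it is enlarged to `8 / δ` at the end.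
  set r := Real.log (2 / δ) with hr
  have hr0 : 0 ≤ r := Real.log_nonneg (by rw [le_div_iff₀ hδ0]; linarith)
  have hexp : Real.exp (-r) = δ / 2 := by
    rw [hr, Real.exp_neg, Real.exp_log (by positivity), inv_div]
  have hL := FreqDecoupling.single_deviation_le hN hlaw hindep
    (FreqDecoupling.measurable_lossL (dH := dH) (B := B) (hFLm gL hgL))
    (hl.mono fun z hz => FreqDecoupling.normLoss_mem_Icc hB (hFLb gL hgL _) hz) hr0
  have hH := FreqDecoupling.uniform_deviation_le hN hlaw hindep hA
    (G := FreqDecoupling.lossClassH B FH)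
    (by rintro _ ⟨g, hg, rfl⟩; exact FreqDecoupling.measurable_lossH (hFHm g hg))
    (by
      filter_upwards [hh] with z hz
      rintro _ ⟨g, hg, rfl⟩
      exact FreqDecoupling.normLoss_mem_Icc hB (hFHb g hg _) hz) hparH hcovH hr0
  rw [hexp] at hL hH
  set badL := {ω | (∑ i, FreqDecoupling.lossL B gL (Z i ω)) / N + Real.sqrt (2 * r / N) ≤
    ∫ z, FreqDecoupling.lossL B gL z ∂μ} with hbadL
  set badH := {ω | ∃ f ∈ FreqDecoupling.lossClassH B FH, (∑ i, f (Z i ω)) / N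
    + (2 * Real.sqrt (2 * (10 * (kL + dH : ℕ) * A + r)) + 4) / Real.sqrt N ≤ ∫ z, f z ∂μ} with hbadH
  -- `badH` is a union over a possibly uncountable class and need not be measurable; a measurable
  -- hull has the same measure.
  set bad := toMeasurable P (badL ∪ badH) with hbad
  have hPbad : P bad ≤ ENNReal.ofReal δ := by
    rw [hbad, measure_toMeasurable]
    calc _ ≤ P badL + P badH := measure_union_le _ _
      _ ≤ ENNReal.ofReal (δ / 2) + ENNReal.ofReal (δ / 2) := add_le_add hL hH
      _ = ENNReal.ofReal δ := by
        rw [← ENNReal.ofReal_add (by positivity) (by positivity), add_halves]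
  have hbadm : MeasurableSet bad := measurableSet_toMeasurable _ _
  refine ⟨badᶜ, hbadm.compl, ?_, ?_⟩
  · rw [probReal_compl_eq_one_sub hbadm]
    have : P.real bad ≤ δ := ENNReal.toReal_le_of_le_ofReal hδ0.le hPbad
    linarith
  · intro ω hω gH hgH
    have hω' : ω ∉ badL ∪ badH := fun h => hω (subset_toMeasurable _ _ h)
    have h1 : ∫ z, FreqDecoupling.lossL B gL z ∂μ <
        (∑ i, FreqDecoupling.lossL B gL (Z i ω)) / N + Real.sqrt (2 * r / N) :=
      not_le.1 fun h => hω' (Or.inl h)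
    have h2 : ∫ z, FreqDecoupling.lossH B gH z ∂μ <
        (∑ i, FreqDecoupling.lossH B gH (Z i ω)) / N
          + (2 * Real.sqrt (2 * (10 * (kL + dH : ℕ) * A + r)) + 4) / Real.sqrt N :=
      not_le.1 fun h => hω' (Or.inr ⟨_, ⟨gH, hgH, rfl⟩, h⟩)
    have h3 := FreqDecoupling.riskReal_le hdH hB hl hh (hFLm gL hgL) (hFLb gL hgL) (hFHm gH hgH)
      (hFHb gH hgH) (hLip gH hgH)
    -- The two confidence terms here and the one from the low-frequency branch make up the factor 3.
    have h4 : (2 * Real.sqrt (2 * (10 * (kL + dH : ℕ) * A + r)) + 4) / Real.sqrt N ≤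
        12 * A * Real.sqrt Real.pi / Real.sqrt N * (Real.sqrt dL + Real.sqrt (kL + dH))
          + 2 * Real.sqrt (2 * r / N) := by
      have h5 := FreqDecoupling.complexity_bound (m := kL + dH) hdL hA hr0
      rw [Real.sqrt_div (by positivity), div_mul_eq_mul_div, ← mul_div_assoc, ← add_div]
      refine div_le_div_of_nonneg_right ?_ (Real.sqrt_nonneg _)
      push_cast at h5 ⊢
      exact h5
    have h6 : Real.sqrt (2 * r / N) ≤ Real.sqrt (2 * Real.log (8 / δ) / N) := by
      rw [hr]
      gcongr
      norm_num
    unfold FreqDecoupling.empRiskDec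
    linarith
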